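/- **Conventions.** For a frame $L$ let $K(L)$ be its set of compact elements. A frame $L$ is *coherent* if every element is a join of compact elements and $K(L)$ is a bounded sublattice of $L$; it is a *Heyting frame* if, in addition, $K(L)$ is closed under the implication of $L$ (so that $K(L)$ is a Heyting subalgebra of $L$). A *coherent frame homomorphism* is a map preserving finite meets, arbitrary joins and compactness of elements. A *Priestley space* is a poset with a compact topology such that, whenever $x\not\le y$, some clopen upset contains $x$ but not $y$; an *Esakia space* is a Priestley space in which ${\downarrow}U$ is clopen for every clopen $U$. An *Esakia morphism* is a continuous map $f:X\to Y$ with ${\downarrow}f^{-1}(y)=f^{-1}({\downarrow}y)$ for all $y\in Y$. Consider the following categories. - $\mathsf{DL}$: bounded distributive lattices and bounded lattice homomorphisms; $\mathsf{HA}$: Heyting algebras and Heyting homomorphisms. - $\mathsf{CohFrm}$: coherent frames and coherent frame homomorphisms; $\mathsf{HeytFrm}$: Heyting frames and those coherent frame homomorphisms $\alpha:L\to M$ whose restriction $K(L)\to K(M)$ is a Heyting homomorphism. - $\mathsf{PS}$: Priestley spaces and continuous order-preserving maps; $\mathsf{ES}$: Esakia spaces and Esakia morphisms. Consider the following functors.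 - $\mathcal J:\mathsf{DL}\to\mathsf{CohFrm}$ sends $A$ to the frame of its ideals and $h:A\to B$ to $I\mapsto{\downarrow}h[I]$. - $\mathcal K:\mathsf{CohFrm}\to\mathsf{DL}$ sends $L$ to $K(L)$ and $\alpha$ to its restriction to compact elements. - $\mathsf{pt}:\mathsf{CohFrm}^{\mathrm{op}}\to\mathsf{PS}$ sends $L$ to the set of its points (completely prime filters), ordered by inclusion and equipped with the patch topology of $\{\zeta(a):a\in L\}$, where $\zeta(a)$ is the set of points containing $a$ (the topology generated by the compact open sets and their complements), and sends $\alpha$ to $\alpha^{-1}$. - $\mathsf{OpUp}:\mathsf{PS}\to\mathsf{CohFrm}^{\mathrm{op}}$ sends $X$ to the frame of its open upsets and $f$ to $f^{-1}$. **Theorem.** The category $\mathsf{HeytFrm}$ is equivalent to $\mathsf{HA}$ and dually equivalent to $\mathsf{ES}$. More precisely, $\mathcal J$ and $\mathcal K$ restrict to functors $\mathsf{HA}\to\mathsf{HeytFrm}$ and $\mathsf{HeytFrm}\to\mathsf{HA}$ that form an equivalence of categories, and $\mathsf{pt}$ and $\mathsf{OpUp}$ restrict to functors $\mathsf{HeytFrm}^{\mathrm{op}}\to\mathsf{ES}$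 and $\mathsf{ES}\to\mathsf{HeytFrm}^{\mathrm{op}}$ that form an equivalence of categories. -/

import Mathlib

open CategoryTheory

universe u

noncomputable section

namespace HeytingFrames

/-! ### Compact elements, coherent frames, Heyting frames -/

/-- A frame is coherent if it is algebraic (every element is a join of compact elements) and its
compact elements form a bounded sublattice. Only closure under `⊤` and `⊓` has to be asked for:
in every complete lattice `⊥` is compact and the join of two compact elements is compact. -/
class IsCoherentFrame (L : Type u) [Order.Frame L] : Prop extends IsCompactlyGenerated L where
  isCompact_top : IsCompactElement (⊤ : L)
  isCompact_inf : ∀ {a b : L}, IsCompactElement a → IsCompactElement b → IsCompactElement (a ⊓ b)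

/-- A Heyting frame is a coherent frame whose compact elements form a Heyting subalgebra, that is,
a bounded sublattice closed under the implication of the frame. -/
class IsHeytingFrame (L : Type u) [Order.Frame L] : Prop extends IsCoherentFrame L where
  isCompact_himp : ∀ {a b : L}, IsCompactElement a → IsCompactElement b → IsCompactElement (a ⇨ b)

theorem isCompactElement_bot {L : Type u} [CompleteLattice L] : IsCompactElement (⊥ : L) := by
  have := CompleteLattice.isCompactElement_finsetSup (α := L) (β := L) (f := id) ∅ (by simp)
  simpa using this

theorem isCompactElement_sup {L : Type u} [CompleteLattice L] {a b : L}
    (ha : IsCompactElement a) (hb : IsCompactElement b) : IsCompactElement (a ⊔ b) := by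
  classical
  have := CompleteLattice.isCompactElement_finsetSup (α := L) (β := L) (f := id) {a, b}
    (by simp [ha, hb])
  simpa using this

/-- The set `K(L)` of compact elements. -/
abbrev CompactElems (L : Type u) [Order.Frame L] : Type u := {a : L // IsCompactElement a}

/-- `K(L)` as a lattice, with the operations of `L`. -/
instance (L : Type u) [Order.Frame L] [IsCoherentFrame L] : DistribLattice (CompactElems L) :=
  { Subtype.lattice (α := L) (P := fun a => IsCompactElement a)
      (fun _ _ ha hb => isCompactElement_sup ha hb)
      (fun _ _ ha hb => IsCoherentFrame.isCompact_inf ha hb) with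
    le_sup_inf := fun a b c => le_sup_inf (x := a.1) (y := b.1) (z := c.1) }

instance (L : Type u) [Order.Frame L] [IsCoherentFrame L] : BoundedOrder (CompactElems L) where
  top := ⟨⊤, IsCoherentFrame.isCompact_top⟩
  le_top a := le_top (a := a.1)
  bot := ⟨⊥, isCompactElement_bot⟩
  bot_le a := bot_le (a := a.1)

/-! ### Categories of frames -/

/-- Coherent frame homomorphisms: frame homomorphisms that preserve compact elements. -/
structure CoherentHom (L M : Type u) [Order.Frame L] [Order.Frame M] extends FrameHom L M where
  map_compact : ∀ {a : L}, IsCompactElement a → IsCompactElement (toFrameHom a)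

@[ext]
theorem CoherentHom.ext {L M : Type u} [Order.Frame L] [Order.Frame M] {f g : CoherentHom L M}
    (h : ∀ a, f.toFrameHom a = g.toFrameHom a) : f = g := by
  obtain ⟨f, _⟩ := f
  obtain ⟨g, _⟩ := g
  have : f = g := FrameHom.ext h
  subst this
  rfl

/-- The category of coherent frames and coherent frame homomorphisms. -/
structure CohFrm where
  carrier : Type u
  [frame : Order.Frame carrier]
  [coherent : IsCoherentFrame carrier]

attribute [instance] CohFrm.frame CohFrm.coherent

instance : Category CohFrm.{u} where
  Hom L M := CoherentHom L.carrier M.carrier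
  id L := ⟨FrameHom.id L.carrier, fun h => h⟩
  comp f g := ⟨g.toFrameHom.comp f.toFrameHom, fun h => g.map_compact (f.map_compact h)⟩

/-- The morphisms of Heyting frames: coherent frame homomorphisms whose restriction to compact
elements is a Heyting homomorphism. The compact elements of a Heyting frame are closed under the
implication of the frame, so their implication is that of the frame; the remaining Heyting
operations are preserved by every frame homomorphism. -/
structure HeytFrmHom (L M : Type u) [Order.Frame L] [Order.Frame M] extends CoherentHom L M where
  map_himp : ∀ {a b : L}, IsCompactElement a → IsCompactElement b →
    toFrameHom (a ⇨ b) = toFrameHom a ⇨ toFrameHom b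

@[ext]
theorem HeytFrmHom.ext {L M : Type u} [Order.Frame L] [Order.Frame M] {f g : HeytFrmHom L M}
    (h : ∀ a, f.toFrameHom a = g.toFrameHom a) : f = g := by
  obtain ⟨f, _⟩ := f
  obtain ⟨g, _⟩ := g
  have : f = g := CoherentHom.ext h
  subst this
  rfl

/-- The category of Heyting frames. -/
structure HeytFrm where
  carrier : Type u
  [frame : Order.Frame carrier]
  [heyting : IsHeytingFrame carrier]

attribute [instance] HeytFrm.frame HeytFrm.heyting

instance : Category HeytFrm.{u} where
  Hom L M := HeytFrmHom L.carrier M.carrier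
  id L := ⟨⟨FrameHom.id L.carrier, fun h => h⟩, fun _ _ => rfl⟩
  comp f g := ⟨⟨g.toFrameHom.comp f.toFrameHom, fun h => g.map_compact (f.map_compact h)⟩,
    fun {a b} ha hb => by
      change g.toFrameHom (f.toFrameHom (a ⇨ b)) =
        g.toFrameHom (f.toFrameHom a) ⇨ g.toFrameHom (f.toFrameHom b)
      rw [f.map_himp ha hb, g.map_himp (f.map_compact ha) (f.map_compact hb)]⟩

/-- The inclusion of the category of Heyting frames into the category of coherent frames. -/
def HeytFrm.toCohFrm : HeytFrm.{u} ⥤ CohFrm.{u} where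
  obj L := ⟨L.carrier⟩
  map f := f.toCoherentHom

/-- The inclusion of the category of Heyting algebras into the category of bounded distributive
lattices. -/
abbrev heytToDL : HeytAlg.{u} ⥤ BddDistLat.{u} := forget₂ HeytAlg BddDistLat

/-! ### Priestley spaces and Esakia spaces -/

/-- The category of Priestley spaces and continuous order-preserving maps. -/
structure PS where
  carrier : Type u
  [order : PartialOrder carrier]
  [top : TopologicalSpace carrier]
  [compact : CompactSpace carrier]
  [priestley : PriestleySpace carrier]

attribute [instance] PS.order PS.top PS.compact PS.priestley

instance : Category PS.{u} where
  Hom X Y := X.carrier →Co Y.carrier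
  id X := ContinuousOrderHom.id X.carrier
  comp f g := g.comp f

/-- The category of Esakia spaces (Priestley spaces in which the downset generated by a clopen set
is clopen) and Esakia morphisms. Continuous maps `f` with `↓ f⁻¹(y) = f⁻¹(↓ y)` for all `y` are
precisely Mathlib's `EsakiaHom`: one inclusion says that `f` is order-preserving, the other that
`f x ≤ y` implies `f z = y` for some `z ≥ x`. -/
structure ES where
  carrier : Type u
  [order : PartialOrder carrier]
  [top : TopologicalSpace carrier]
  [compact : CompactSpace carrier]
  [priestley : PriestleySpace carrier]
  isClopen_down : ∀ U : Set carrier, IsClopen U → IsClopen (lowerClosure U : Set carrier)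

attribute [instance] ES.order ES.top ES.compact ES.priestley

instance : Category ES.{u} where
  Hom X Y := EsakiaHom X.carrier Y.carrier
  id X := EsakiaHom.id X.carrier
  comp f g := g.comp f

/-- The inclusion of the category of Esakia spaces into the category of Priestley spaces. -/
def ES.toPS : ES.{u} ⥤ PS.{u} where
  obj X := ⟨X.carrier⟩
  map f := f.toContinuousOrderHom

/-! ### The functor of compact elements -/

/-- The functor `𝒦` sends `L` to the bounded distributive lattice `K(L)` of its compact elements
and a coherent frame homomorphism to its restriction. -/
def compactElements : CohFrm.{u} ⥤ BddDistLat.{u} where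
  obj L := BddDistLat.of (CompactElems L.carrier)
  map f := BddDistLat.ofHom
    { toFun := fun a => ⟨f.toFrameHom a.1, f.map_compact a.2⟩
      map_sup' := fun a b => Subtype.ext (map_sup f.toFrameHom a.1 b.1)
      map_inf' := fun a b => Subtype.ext (map_inf f.toFrameHom a.1 b.1)
      map_top' := Subtype.ext (map_top f.toFrameHom)
      map_bot' := Subtype.ext (map_bot f.toFrameHom) }

/-! ### The functor of ideals -/

section Ideals

variable {A B : Type u} [DistribLattice A] [BoundedOrder A] [DistribLattice B] [BoundedOrder B]

/-- The implication of ideals. -/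
def idealImp (I J : Order.Ideal A) : Order.Ideal A where
  carrier := {a | ∀ b ∈ I, a ⊓ b ∈ J}
  lower' _ _ hle h b hb := J.lower (inf_le_inf_right b hle) (h b hb)
  nonempty' := ⟨⊥, fun b _ => by simp⟩
  directed' a ha b hb := ⟨a ⊔ b, fun c hc => by
    rw [inf_sup_right]
    exact Order.Ideal.sup_mem (ha c hc) (hb c hc), le_sup_left, le_sup_right⟩

/-- The ideals of a bounded distributive lattice, ordered by inclusion, form a frame. -/
instance : Order.Frame (Order.Ideal A) :=
  Order.Frame.ofMinimalAxioms
    { inf_sSup_le_iSup_inf := fun I S => by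
        have h : sSup S ≤ idealImp I (⨆ J ∈ S, I ⊓ J) := sSup_le fun J hJ a ha b hb =>
          (le_iSup₂_of_le (f := fun J (_ : J ∈ S) => I ⊓ J) J hJ le_rfl :
            I ⊓ J ≤ ⨆ J ∈ S, I ⊓ J)
            ⟨I.lower inf_le_right hb, J.lower inf_le_left ha⟩
        intro a ha
        simpa using h ha.2 a ha.1 }

theorem isCompactElement_principal (a : A) : IsCompactElement (Order.Ideal.principal a) := by
  intro S u hne hdir hlub hle
  let U : Order.Ideal A :=
    { carrier := {x | ∃ I ∈ S, x ∈ I}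
      lower' := fun x y hyx ⟨I, hI, hx⟩ => ⟨I, hI, I.lower hyx hx⟩
      nonempty' := by
        obtain ⟨I, hI⟩ := hne
        exact ⟨⊥, I, hI, by simp⟩
      directed' := by
        rintro x ⟨I, hI, hx⟩ y ⟨J, hJ, hy⟩
        obtain ⟨M, hM, hIM, hJM⟩ := hdir I hI J hJ
        exact ⟨x ⊔ y, ⟨M, hM, Order.Ideal.sup_mem (hIM hx) (hJM hy)⟩, le_sup_left, le_sup_right⟩ }
  have hU : u ≤ U := hlub.2 fun I hI x hx => ⟨I, hI, hx⟩
  obtain ⟨I, hI, h⟩ := hU (hle (Order.Ideal.mem_principal_self (x := a)))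
  exact ⟨I, hI, by simpa using h⟩

theorem isCompactElement_ideal_iff {I : Order.Ideal A} :
    IsCompactElement I ↔ ∃ a, I = Order.Ideal.principal a := by
  constructor
  · intro h
    obtain ⟨_, ⟨a, ha, rfl⟩, hle⟩ := h (Order.Ideal.principal '' I) I (I.nonempty.image _) (by
        rintro _ ⟨a, ha, rfl⟩ _ ⟨b, hb, rfl⟩
        exact ⟨_, ⟨a ⊔ b, Order.Ideal.sup_mem ha hb, rfl⟩, by simp, by simp⟩) (by
        constructor
        · rintro _ ⟨a, ha, rfl⟩
          simpa using ha
        · intro J hJ a ha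
          simpa using hJ ⟨a, ha, rfl⟩) le_rfl
    exact ⟨a, le_antisymm hle (by simpa using ha)⟩
  · rintro ⟨a, rfl⟩
    exact isCompactElement_principal a

instance : IsCoherentFrame (Order.Ideal A) where
  exists_sSup_eq I := ⟨Order.Ideal.principal '' I, by
    rintro _ ⟨a, _, rfl⟩
    exact isCompactElement_principal a, by
    apply le_antisymm
    · apply sSup_le
      rintro _ ⟨a, ha, rfl⟩
      simpa using ha
    · intro a ha
      have : Order.Ideal.principal a ≤ sSup (Order.Ideal.principal '' (I : Set A)) :=
        le_sSup ⟨a, ha, rfl⟩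
      simpa using this⟩
  isCompact_top := by
    have := isCompactElement_principal (⊤ : A)
    rwa [Order.Ideal.principal_top] at this
  isCompact_inf hI hJ := by
    obtain ⟨a, rfl⟩ := isCompactElement_ideal_iff.1 hI
    obtain ⟨b, rfl⟩ := isCompactElement_ideal_iff.1 hJ
    refine isCompactElement_ideal_iff.2 ⟨a ⊓ b, ?_⟩
    ext x
    simp

/-- The ideal `h*(I) = ↓ h[I]`. -/
def idealMapFun (h : BoundedLatticeHom A B) (I : Order.Ideal A) : Order.Ideal B where
  carrier := {b | ∃ a ∈ I, b ≤ h a}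
  lower' _ _ hle := fun ⟨a, ha, hb⟩ => ⟨a, ha, hle.trans hb⟩
  nonempty' := ⟨⊥, ⊥, Order.Ideal.bot_mem I, bot_le⟩
  directed' := by
    rintro x ⟨a, ha, hx⟩ y ⟨b, hb, hy⟩
    exact ⟨x ⊔ y, ⟨a ⊔ b, Order.Ideal.sup_mem ha hb, by
      rw [map_sup]; exact sup_le_sup hx hy⟩, le_sup_left, le_sup_right⟩

theorem idealMapFun_mono (h : BoundedLatticeHom A B) : Monotone (idealMapFun h) :=
  fun _ _ hle _ ⟨a, ha, hb⟩ => ⟨a, hle ha, hb⟩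

/-- The preimage of an ideal. -/
def idealComap (h : BoundedLatticeHom A B) (J : Order.Ideal B) : Order.Ideal A where
  carrier := {a | h a ∈ J}
  lower' _ _ hle ha := J.lower (OrderHomClass.mono h hle) ha
  nonempty' := ⟨⊥, by
    change h ⊥ ∈ J
    rw [map_bot]
    exact Order.Ideal.bot_mem J⟩
  directed' a ha b hb := ⟨a ⊔ b, by
    change h (a ⊔ b) ∈ J
    rw [map_sup]
    exact Order.Ideal.sup_mem ha hb, le_sup_left, le_sup_right⟩

/-- The coherent frame homomorphism `h*` induced by a bounded lattice homomorphism `h`. -/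
def idealMap (h : BoundedLatticeHom A B) : CoherentHom (Order.Ideal A) (Order.Ideal B) where
  toFun := idealMapFun h
  map_inf' I J := by
    apply le_antisymm
    · exact le_inf (idealMapFun_mono h inf_le_left) (idealMapFun_mono h inf_le_right)
    · rintro b ⟨⟨x, hx, hbx⟩, ⟨y, hy, hby⟩⟩
      exact ⟨x ⊓ y, ⟨I.lower inf_le_left hx, J.lower inf_le_right hy⟩, by
        rw [map_inf]; exact le_inf hbx hby⟩
  map_top' := top_le_iff.1 fun b _ => ⟨⊤, trivial, by
    rw [map_top]
    exact le_top⟩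
  map_sSup' S := by
    apply le_antisymm
    · have : sSup S ≤ idealComap h (sSup (idealMapFun h '' S)) := sSup_le fun I hI a ha =>
        (le_sSup ⟨I, hI, rfl⟩ : idealMapFun h I ≤ sSup (idealMapFun h '' S)) ⟨a, ha, le_rfl⟩
      rintro b ⟨a, ha, hb⟩
      exact Order.Ideal.lower _ hb (this ha)
    · apply sSup_le
      rintro _ ⟨I, hI, rfl⟩
      exact idealMapFun_mono h (le_sSup hI)
  map_compact {I} hI := by
    obtain ⟨a, rfl⟩ := isCompactElement_ideal_iff.1 hI
    refine isCompactElement_ideal_iff.2 ⟨h a, ?_⟩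
    apply le_antisymm
    · rintro b ⟨x, hx, hb⟩
      exact hb.trans (OrderHomClass.mono h hx)
    · intro b hb
      exact ⟨a, le_rfl, hb⟩

end Ideals

/-- The functor `𝒥` sends `A` to the frame of its ideals and `h` to `h*`. -/
def ideals : BddDistLat.{u} ⥤ CohFrm.{u} where
  obj A := ⟨Order.Ideal A⟩
  map h := idealMap h.hom
  map_id A := CoherentHom.ext fun I => by
    apply le_antisymm
    · rintro b ⟨a, ha, hb⟩
      exact I.lower hb ha
    · intro b hb
      exact ⟨b, hb, le_rfl⟩
  map_comp f g := CoherentHom.ext fun I => by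
    apply le_antisymm
    · rintro c ⟨a, ha, hc⟩
      exact ⟨f.hom a, ⟨a, ha, le_rfl⟩, hc⟩
    · rintro c ⟨b, ⟨a, ha, hb⟩, hc⟩
      exact ⟨a, ha, hc.trans (OrderHomClass.mono g.hom hb)⟩

/-! ### The functor of open upsets -/

/-- The open upsets of an ordered topological space. -/
@[ext]
structure OpUp (X : Type u) [PartialOrder X] [TopologicalSpace X] where
  carrier : Set X
  isOpen : IsOpen carrier
  isUpper : IsUpperSet carrier

namespace OpUp

section Frame

variable {X : Type u} [PartialOrder X] [TopologicalSpace X]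

instance : SetLike (OpUp X) X where
  coe := carrier
  coe_injective _ _ h := OpUp.ext h

instance : PartialOrder (OpUp X) := .ofSetLike (OpUp X) X

instance : SupSet (OpUp X) where
  sSup S :=
    ⟨⋃ U ∈ S, (U : Set X), isOpen_biUnion fun U _ => U.isOpen,
      isUpperSet_iUnion₂ fun U _ => U.isUpper⟩

theorem mem_sSup {S : Set (OpUp X)} {x : X} : x ∈ sSup S ↔ ∃ U ∈ S, x ∈ U := by
  change x ∈ ⋃ U ∈ S, (U : Set X) ↔ _
  simp

/-- Joins of open upsets are unions and finite meets are intersections. -/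
instance : CompleteLattice (OpUp X) :=
  { completeLatticeOfSup (OpUp X) fun S =>
      ⟨fun U hU _ hx => mem_sSup.2 ⟨U, hU, hx⟩, fun V hV x hx => by
        obtain ⟨U, hU, hx⟩ := mem_sSup.1 hx
        exact hV hU hx⟩ with
    inf := fun U V => ⟨U.carrier ∩ V.carrier, U.isOpen.inter V.isOpen, U.isUpper.inter V.isUpper⟩
    inf_le_left := fun _ _ _ hx => hx.1
    inf_le_right := fun _ _ _ hx => hx.2
    le_inf := fun _ _ _ h₁ h₂ _ hx => ⟨h₁ hx, h₂ hx⟩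
    top := ⟨Set.univ, isOpen_univ, isUpperSet_univ⟩
    le_top := fun _ _ _ => trivial }

theorem mem_inf {U V : OpUp X} {x : X} : x ∈ U ⊓ V ↔ x ∈ U ∧ x ∈ V := Iff.rfl

instance : Order.Frame (OpUp X) :=
  Order.Frame.ofMinimalAxioms
    { inf_sSup_le_iSup_inf := fun U S x hx => by
        obtain ⟨V, hV, hxV⟩ := mem_sSup.1 hx.2
        exact (le_iSup₂_of_le (f := fun V (_ : V ∈ S) => U ⊓ V) V hV le_rfl :
          U ⊓ V ≤ ⨆ V ∈ S, U ⊓ V) ⟨hx.1, hxV⟩ }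

variable [CompactSpace X] [PriestleySpace X]

theorem exists_isClopen {U : OpUp X} {x : X} (hx : x ∈ U) :
    ∃ V : OpUp X, IsClopen (V : Set X) ∧ x ∈ V ∧ V ≤ U := by
  have hK : IsCompact ((U : Set X)ᶜ) := U.isOpen.isClosed_compl.isCompact
  have hsep : ∀ y ∈ (U : Set X)ᶜ, ∃ V : Set X, IsClopen V ∧ IsUpperSet V ∧ x ∈ V ∧ y ∉ V :=
    fun y hy => exists_isClopen_upper_of_not_le fun hle => hy (U.isUpper hle hx)
  choose! V hV using hsep
  obtain ⟨t, ht, hcov⟩ := hK.elim_nhds_subcover (fun y => (V y)ᶜ) fun y hy =>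
    (hV y hy).1.compl.isOpen.mem_nhds (hV y hy).2.2.2
  have hclopen : IsClopen (⋂ y ∈ t, V y) := t.finite_toSet.isClopen_biInter fun y hy =>
    (hV y (ht y hy)).1
  refine ⟨⟨⋂ y ∈ t, V y, hclopen.isOpen, isUpperSet_iInter₂ fun y hy => (hV y (ht y hy)).2.1⟩,
    hclopen, ?_, ?_⟩
  · exact Set.mem_iInter₂.2 fun y hy => (hV y (ht y hy)).2.2.1
  · intro z hz
    by_contra hzU
    obtain ⟨y, hy, hzy⟩ := Set.mem_iUnion₂.1 (hcov hzU)
    exact hzy (Set.mem_iInter₂.1 hz y hy)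

theorem isCompactElement_iff {U : OpUp X} : IsCompactElement U ↔ IsClopen (U : Set X) := by
  constructor
  · intro h
    obtain ⟨V, ⟨hV, hVU⟩, hle⟩ := h {V | IsClopen (V : Set X) ∧ V ≤ U} U
      ⟨⟨∅, isOpen_empty, isUpperSet_empty⟩, isClopen_empty, fun _ hx => hx.elim⟩
      (by
        rintro V ⟨hV, hVU⟩ W ⟨hW, hWU⟩
        exact ⟨⟨V ∪ W, V.isOpen.union W.isOpen, V.isUpper.union W.isUpper⟩,
          ⟨hV.union hW, fun x hx => hx.elim (fun h => hVU h) (fun h => hWU h)⟩,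
          fun _ hx => Or.inl hx, fun _ hx => Or.inr hx⟩)
      ⟨fun V hV => hV.2, fun W hW x hx => by
        obtain ⟨V, hV, hxV, hVU⟩ := exists_isClopen hx
        exact hW ⟨hV, hVU⟩ hxV⟩ le_rfl
    rwa [le_antisymm hle hVU]
  · intro hU S W hne hdir hlub hle
    have hW : W ≤ sSup S := hlub.2 fun V hV => le_sSup hV
    have : Nonempty S := hne.to_subtype
    obtain ⟨V, hV⟩ := hU.isClosed.isCompact.elim_directed_cover
      (fun V : S => (V.1 : Set X)) (fun V => V.1.isOpen)
      (fun x hx => by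
        obtain ⟨V, hV, hxV⟩ := mem_sSup.1 (hW (hle hx))
        exact Set.mem_iUnion.2 ⟨⟨V, hV⟩, hxV⟩)
      (fun V W => by
        obtain ⟨Z, hZ, h₁, h₂⟩ := hdir V.1 V.2 W.1 W.2
        exact ⟨⟨Z, hZ⟩, h₁, h₂⟩)
    exact ⟨V.1, V.2, hV⟩

instance : IsCoherentFrame (OpUp X) where
  exists_sSup_eq U := ⟨{V | IsClopen (V : Set X) ∧ V ≤ U},
    fun V hV => isCompactElement_iff.2 hV.1,
    le_antisymm (sSup_le fun V hV => hV.2) fun x hx => by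
      obtain ⟨V, hV, hxV, hVU⟩ := exists_isClopen hx
      exact mem_sSup.2 ⟨V, ⟨hV, hVU⟩, hxV⟩⟩
  isCompact_top := isCompactElement_iff.2 isClopen_univ
  isCompact_inf hU hV := isCompactElement_iff.2
    ((isCompactElement_iff.1 hU).inter (isCompactElement_iff.1 hV))

end Frame

/-- The coherent frame homomorphism `f⁻¹` induced by a Priestley morphism `f`. -/
def preimage {X Y : Type u} [PartialOrder X] [TopologicalSpace X] [CompactSpace X]
    [PriestleySpace X] [PartialOrder Y] [TopologicalSpace Y] [CompactSpace Y] [PriestleySpace Y]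
    (f : X →Co Y) : CoherentHom (OpUp Y) (OpUp X) where
  toFun U := ⟨f ⁻¹' U, U.isOpen.preimage f.continuous_toFun, fun _ _ hle hx =>
    U.isUpper (f.monotone' hle) hx⟩
  map_inf' _ _ := rfl
  map_top' := rfl
  map_sSup' S := by
    apply le_antisymm
    · intro x hx
      obtain ⟨U, hU, hx⟩ := mem_sSup.1 hx
      exact mem_sSup.2 ⟨_, ⟨U, hU, rfl⟩, hx⟩
    · intro x hx
      obtain ⟨_, ⟨U, hU, rfl⟩, hx⟩ := mem_sSup.1 hx
      exact mem_sSup.2 ⟨U, hU, hx⟩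
  map_compact hU := isCompactElement_iff.2
    ((isCompactElement_iff.1 hU).preimage f.continuous_toFun)

end OpUp

/-- The contravariant functor `OpUp` sends a Priestley space to the frame of its open upsets and
`f` to `f⁻¹`. -/
def openUpsets : PS.{u} ⥤ CohFrm.{u}ᵒᵖ where
  obj X := Opposite.op ⟨OpUp X.carrier⟩
  map f := Quiver.Hom.op (V := CohFrm.{u}) (OpUp.preimage f)

/-! ### The functor of points -/

/-- The points of a frame: completely prime filters. -/
structure Pt (L : Type u) [Order.Frame L] where
  toPFilter : Order.PFilter L
  completelyPrime : ∀ S : Set L, sSup S ∈ toPFilter → ∃ a ∈ S, a ∈ toPFilter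

namespace Pt

section Frame

variable {L : Type u} [Order.Frame L]

instance : SetLike (Pt L) L where
  coe P := P.toPFilter
  coe_injective := by
    rintro ⟨P, _⟩ ⟨Q, _⟩ h
    have : P = Q := SetLike.coe_injective h
    subst this
    rfl

/-- Points are ordered by inclusion. -/
instance : PartialOrder (Pt L) := .ofSetLike (Pt L) L

theorem mem_of_le {P : Pt L} {a b : L} (h : a ≤ b) (ha : a ∈ P) : b ∈ P :=
  Order.PFilter.mem_of_le (F := P.toPFilter) h ha

theorem mem_sSup_iff {P : Pt L} {S : Set L} : sSup S ∈ P ↔ ∃ a ∈ S, a ∈ P :=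
  ⟨P.completelyPrime S, fun ⟨_, ha, h⟩ => mem_of_le (le_sSup ha) h⟩

theorem mem_top (P : Pt L) : (⊤ : L) ∈ P := Order.PFilter.top_mem (F := P.toPFilter)

theorem mem_inf_iff {P : Pt L} {a b : L} : a ⊓ b ∈ P ↔ a ∈ P ∧ b ∈ P :=
  Order.PFilter.inf_mem_iff (F := P.toPFilter)

/-- The set `ζ(a)` of points that contain `a`. -/
def zeta (a : L) : Set (Pt L) := {P | a ∈ P}

theorem zeta_sSup (S : Set L) : zeta (sSup S) = ⋃ a ∈ S, zeta a := by
  ext P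
  simpa [zeta] using mem_sSup_iff

theorem zeta_mono {a b : L} (h : a ≤ b) : zeta a ⊆ zeta b := fun _ ha => mem_of_le h ha

/-- The topology `τ = {ζ(a) : a ∈ L}` on the set of points. -/
abbrev tau (L : Type u) [Order.Frame L] : TopologicalSpace (Pt L) where
  IsOpen U := ∃ a : L, zeta a = U
  isOpen_univ := ⟨⊤, Set.eq_univ_of_forall mem_top⟩
  isOpen_inter := by
    rintro _ _ ⟨a, rfl⟩ ⟨b, rfl⟩
    exact ⟨a ⊓ b, Set.ext fun P => mem_inf_iff⟩
  isOpen_sUnion := by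
    intro s hs
    refine ⟨sSup {a | zeta a ∈ s}, ?_⟩
    rw [zeta_sSup]
    ext P
    simp only [Set.mem_iUnion, Set.mem_sUnion, Set.mem_ofPred_eq, exists_prop]
    constructor
    · rintro ⟨a, ha, hP⟩
      exact ⟨_, ha, hP⟩
    · rintro ⟨U, hU, hP⟩
      obtain ⟨a, rfl⟩ := hs U hU
      exact ⟨a, hU, hP⟩

/-- The set of points carries the patch topology of `τ`: it is generated by the compact open sets
of `τ` and their complements. -/
instance : TopologicalSpace (Pt L) := @constructibleTopology (Pt L) (tau L)

end Frame

/-- The preimage `α⁻¹(P)` of a point `P`. -/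
def comapFun {L M : Type u} [Order.Frame L] [Order.Frame M] (f : FrameHom L M) (P : Pt M) : Pt L where
  toPFilter := Order.IsPFilter.toPFilter (F := {a | f a ∈ P}) <| by
    refine Order.IsPFilter.of_def ⟨⊤, ?_⟩ ?_ ?_
    · change f ⊤ ∈ P
      rw [map_top]
      exact mem_top P
    · intro a ha b hb
      refine ⟨a ⊓ b, ?_, inf_le_left, inf_le_right⟩
      change f (a ⊓ b) ∈ P
      rw [map_inf]
      exact mem_inf_iff.2 ⟨ha, hb⟩
    · intro a b hab ha
      exact mem_of_le (OrderHomClass.mono f hab) ha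
  completelyPrime S hS := by
    have hS' : f (sSup S) ∈ P := hS
    rw [map_sSup] at hS'
    obtain ⟨_, ⟨a, ha, rfl⟩, hP⟩ := mem_sSup_iff.1 hS'
    exact ⟨a, ha, hP⟩

section Coherent

variable {L : Type u} [Order.Frame L] [IsCoherentFrame L]

theorem exists_compact_of_mem {P : Pt L} {a : L} (ha : a ∈ P) :
    ∃ k, IsCompactElement k ∧ k ≤ a ∧ k ∈ P := by
  rw [← sSup_compact_le_eq a] at ha
  obtain ⟨k, hk, hP⟩ := mem_sSup_iff.1 ha
  exact ⟨k, hk.1, hk.2, hP⟩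

/-- The limit of an ultrafilter of points. -/
def lim (F : Ultrafilter (Pt L)) : Pt L where
  toPFilter := Order.IsPFilter.toPFilter
    (F := {a | ∃ k, IsCompactElement k ∧ k ≤ a ∧ zeta k ∈ F}) <| by
      refine Order.IsPFilter.of_def ?_ ?_ ?_
      · refine ⟨⊤, ⊤, IsCoherentFrame.isCompact_top, le_rfl, ?_⟩
        rw [show zeta (⊤ : L) = Set.univ from Set.eq_univ_of_forall mem_top]
        exact Filter.univ_mem
      · rintro a ⟨k, hk, hka, hkF⟩ b ⟨l, hl, hlb, hlF⟩
        refine ⟨a ⊓ b, ⟨k ⊓ l, IsCoherentFrame.isCompact_inf hk hl, inf_le_inf hka hlb, ?_⟩,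
          inf_le_left, inf_le_right⟩
        exact Filter.mem_of_superset (Filter.inter_mem hkF hlF) fun P hP => mem_inf_iff.2 hP
      · rintro a b hab ⟨k, hk, hka, hkF⟩
        exact ⟨k, hk, hka.trans hab, hkF⟩
  completelyPrime := by
    rintro S ⟨k, hk, hkS, hkF⟩
    have hS : k ≤ sSup {l : L | IsCompactElement l ∧ ∃ a ∈ S, l ≤ a} := hkS.trans <|
      sSup_le fun a ha => by
        rw [← sSup_compact_le_eq a]
        exact sSup_le_sSup fun l hl => ⟨hl.1, a, ha, hl.2⟩
    obtain ⟨T, hT, hkT⟩ :=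
      (CompleteLattice.isCompactElement_iff_exists_le_sSup_of_le_sSup L k).1 hk _ hS
    have hmem : (⋃ l ∈ (T : Set L), zeta l) ∈ F := by
      rw [← zeta_sSup, ← Finset.sup_id_eq_sSup]
      exact Filter.mem_of_superset hkF (zeta_mono hkT)
    obtain ⟨l, hl, hlF⟩ := (Ultrafilter.finite_biUnion_mem_iff T.finite_toSet).1 hmem
    obtain ⟨hlc, a, ha, hla⟩ := hT hl
    exact ⟨a, ha, l, hlc, hla, hlF⟩

theorem mem_lim {F : Ultrafilter (Pt L)} {a : L} :
    a ∈ lim F ↔ ∃ k, IsCompactElement k ∧ k ≤ a ∧ zeta k ∈ F := Iff.rfl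

theorem zeta_mem_of_mem_lim {F : Ultrafilter (Pt L)} {a : L} (h : a ∈ lim F) : zeta a ∈ F := by
  obtain ⟨k, _, hka, hkF⟩ := mem_lim.1 h
  exact Filter.mem_of_superset hkF (zeta_mono hka)

theorem isCompact_zeta {k : L} (hk : IsCompactElement k) : @IsCompact _ (tau L) (zeta k) := by
  let := tau L
  rw [isCompact_iff_ultrafilter_le_nhds']
  intro F hF
  refine ⟨lim F, show k ∈ lim F from mem_lim.2 ⟨k, hk, le_rfl, hF⟩, ?_⟩
  intro U hU
  obtain ⟨V, hVU, ⟨a, rfl⟩, ha⟩ := mem_nhds_iff.1 hU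
  exact Filter.mem_of_superset (zeta_mem_of_mem_lim ha) hVU

theorem exists_eq_zeta {U : Set (Pt L)} (hU : @IsOpen _ (tau L) U) (hc : @IsCompact _ (tau L) U) :
    ∃ k : L, IsCompactElement k ∧ U = zeta k := by
  let := tau L
  obtain ⟨a, rfl⟩ := hU
  obtain ⟨T, hT⟩ := hc.elim_finite_subcover
    (fun k : {k : L // IsCompactElement k ∧ k ≤ a} => zeta k.1) (fun k => ⟨k.1, rfl⟩)
    (fun P hP => by
      obtain ⟨k, hk, hka, hkP⟩ := exists_compact_of_mem hP
      exact Set.mem_iUnion.2 ⟨⟨k, hk, hka⟩, hkP⟩)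
  refine ⟨T.sup Subtype.val, CompleteLattice.isCompactElement_finsetSup T fun k _ => k.2.1, ?_⟩
  apply Set.Subset.antisymm
  · intro P hP
    obtain ⟨k, hk, hkP⟩ := Set.mem_iUnion₂.1 (hT hP)
    exact zeta_mono (Finset.le_sup (f := Subtype.val) hk) hkP
  · exact zeta_mono (Finset.sup_le fun k _ => k.2.2)

theorem isClopen_zeta {k : L} (hk : IsCompactElement k) : IsClopen (zeta k) := by
  have ho : @IsOpen _ (tau L) (zeta k) := ⟨k, rfl⟩
  constructor
  · rw [← isOpen_compl_iff]
    refine TopologicalSpace.isOpen_generateFrom_of_mem (Or.inr ⟨?_, ?_⟩)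
    · let := tau L
      exact isClosed_compl_iff.2 ho
    · rw [compl_compl]
      exact isCompact_zeta hk
  · exact TopologicalSpace.isOpen_generateFrom_of_mem (Or.inl ⟨ho, isCompact_zeta hk⟩)

theorem subbasis_cases {s : Set (Pt L)}
    (hs : s ∈ @constructibleTopologySubbasis (Pt L) (tau L)) :
    ∃ k : L, IsCompactElement k ∧ (s = zeta k ∨ s = (zeta k)ᶜ) := by
  rcases hs with ⟨ho, hc⟩ | ⟨ho, hc⟩
  · obtain ⟨k, hk, rfl⟩ := exists_eq_zeta ho hc
    exact ⟨k, hk, Or.inl rfl⟩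
  · obtain ⟨k, hk, h⟩ := exists_eq_zeta ((@isOpen_compl_iff _ _ (tau L)).2 ho) hc
    exact ⟨k, hk, Or.inr (by rw [← h, compl_compl])⟩

instance : CompactSpace (Pt L) := by
  constructor
  rw [isCompact_iff_ultrafilter_le_nhds']
  intro F _
  refine ⟨lim F, trivial, ?_⟩
  rw [← Filter.tendsto_id']
  refine TopologicalSpace.tendsto_nhds_generateFrom_iff.2 fun s hs hmem => ?_
  obtain ⟨k, hk, rfl | rfl⟩ := subbasis_cases hs
  · exact zeta_mem_of_mem_lim hmem
  · refine Ultrafilter.compl_mem_iff_notMem.2 fun h => hmem ?_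
    exact (mem_lim (a := k)).2 ⟨k, hk, le_rfl, h⟩

instance : PriestleySpace (Pt L) where
  priestley {P Q} h := by
    obtain ⟨a, haP, haQ⟩ := SetLike.not_le_iff_exists.1 h
    obtain ⟨k, hk, hka, hkP⟩ := exists_compact_of_mem haP
    exact ⟨zeta k, isClopen_zeta hk, fun P Q hle hP => hle hP, hkP,
      fun hkQ => haQ (mem_of_le hka hkQ)⟩

/-- The Priestley morphism `α⁻¹` induced by a coherent frame homomorphism `α`. -/
def comap {M : Type u} [Order.Frame M] [IsCoherentFrame M] (f : CoherentHom L M) :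
    Pt M →Co Pt L where
  toFun := comapFun f.toFrameHom
  monotone' _ _ hle _ ha := hle ha
  continuous_toFun := by
    refine continuous_generateFrom_iff.2 fun s hs => ?_
    obtain ⟨k, hk, rfl | rfl⟩ := subbasis_cases hs
    · exact (isClopen_zeta (f.map_compact hk)).isOpen
    · exact (isClopen_zeta (f.map_compact hk)).compl.isOpen

end Coherent

end Pt

/-- The contravariant functor `pt` sends a coherent frame to the Priestley space of its points
(with the patch topology, ordered by inclusion) and `α` to `α⁻¹`. -/
def points : CohFrm.{u}ᵒᵖ ⥤ PS.{u} where
  obj L := ⟨Pt L.unop.carrier⟩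
  map f := Pt.comap f.unop

end HeytingFrames

end

/-!
The equivalence, given by `𝒥` and `𝒦`, between bounded distributive lattices and coherent frames
rests on two order isomorphisms: a lattice `A` is the lattice of compact (that is, principal)
ideals of its ideal frame (`principalIso`), and a coherent frame `L` is the ideal frame of `K(L)`
(`idealsIso`). Both are natural. An order isomorphism preserves every Heyting operation, so only
the functors have to be checked: `𝒥` lands in Heyting frames because `↓a ⇨ ↓b = ↓(a ⇨ b)`
(`principal_himp`), and `𝒦` does by the definition of a Heyting frame.

For the duality, the prime ideal theorem for `K(L)` gives enough points to separate filters from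
ideals of compact elements (`Pt.exists_separating`). It has three consequences.
* `ζ` is an order isomorphism from `L` onto the open upsets of `pt L` (`Pt.zetaIso`).
* For compact `a` and `b`, the downset of `ζ(a) \ ζ(b)` is the complement of `ζ(a ⇨ b)`
  (`Pt.lowerClosure_zeta_diff`). Every clopen set is a finite union of sets `ζ(a) \ ζ(b)`, so
  `pt L` is an Esakia space when `L` is a Heyting frame.
* If `α` preserves implications of compact elements, then `α⁻¹` is a p-morphism
  (`Pt.exists_le_comapFun_eq`).

In the other direction, `U ⇨ V` is the complement of `↓(U \ V)` when the latter is closed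
(`OpUp.mem_himp`), so the open upsets of an Esakia space form a Heyting frame, and preimages under
Esakia morphisms preserve the implication of clopen upsets. Finally `x ↦ {U | x ∈ U}` is a
continuous order isomorphism from `X` onto `pt (OpUp X)`: its image is closed and dense
(`pointOf_surjective`).
-/

namespace HeytingFrames

/-! ### Isomorphisms of Heyting frames -/

section FrameIso

variable {L M : Type u} [Order.Frame L] [Order.Frame M]

theorem isCompactElement_orderIso (e : L ≃o M) {a : L} (ha : IsCompactElement a) :
    IsCompactElement (e a) := by
  intro S v hne hdir hlub hle
  obtain ⟨_, ⟨b, hb, rfl⟩, hab⟩ := ha (e.symm '' S) (e.symm v) (hne.image _)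
    (hdir.mono_comp fun _ _ h => e.symm.monotone h) (e.symm.isLUB_image'.2 hlub)
    (e.le_symm_apply.2 hle)
  exact ⟨b, hb, e.le_symm_apply.1 hab⟩

/-- An order isomorphism of frames as a morphism of Heyting frames. -/
def HeytFrmHom.ofOrderIso (e : L ≃o M) : HeytFrmHom L M where
  toFun := e
  map_inf' := map_inf e
  map_top' := map_top e
  map_sSup' := map_sSup e
  map_compact := isCompactElement_orderIso e
  map_himp _ _ := HeytingHomClass.map_himp e _ _

end FrameIso

/-- An order isomorphism of Heyting frames as an isomorphism in the category of Heyting frames. -/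
def HeytFrm.isoOfOrderIso {L M : HeytFrm.{u}} (e : L.carrier ≃o M.carrier) : L ≅ M where
  hom := HeytFrmHom.ofOrderIso e
  inv := HeytFrmHom.ofOrderIso e.symm
  hom_inv_id := HeytFrmHom.ext e.symm_apply_apply
  inv_hom_id := HeytFrmHom.ext e.apply_symm_apply

/-! ### Ideals of a Heyting algebra -/

section Ideals

variable {A B : Type u} [HeytingAlgebra A] [HeytingAlgebra B]

theorem principal_himp (a b : A) :
    Order.Ideal.principal a ⇨ Order.Ideal.principal b = Order.Ideal.principal (a ⇨ b) := by
  apply le_antisymm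
  · intro c hc
    have h : Order.Ideal.principal c ⊓ Order.Ideal.principal a ≤ Order.Ideal.principal b :=
      le_himp_iff.1 (Order.Ideal.principal_le_iff.2 hc)
    exact le_himp_iff.2 (h ⟨inf_le_left, inf_le_right⟩)
  · rw [le_himp_iff]
    rintro c ⟨hc, hca⟩
    exact (le_inf hc hca).trans himp_inf_le

instance : IsHeytingFrame (Order.Ideal A) where
  isCompact_himp hI hJ := by
    obtain ⟨a, rfl⟩ := isCompactElement_ideal_iff.1 hI
    obtain ⟨b, rfl⟩ := isCompactElement_ideal_iff.1 hJ
    rw [principal_himp]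
    exact isCompactElement_principal _

theorem idealMapFun_principal {A B : Type u} [DistribLattice A] [BoundedOrder A]
    [DistribLattice B] [BoundedOrder B] (h : BoundedLatticeHom A B) (a : A) :
    idealMapFun h (Order.Ideal.principal a) = Order.Ideal.principal (h a) :=
  le_antisymm (fun _ ⟨_, hx, hb⟩ => hb.trans (OrderHomClass.mono h hx))
    fun _ hb => ⟨a, le_rfl, hb⟩

end Ideals

/-- The restriction of the functor of ideals to Heyting algebras, with values in Heyting frames. -/
def heytIdeals : HeytAlg.{u} ⥤ HeytFrm.{u} where
  obj A := ⟨Order.Ideal A⟩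
  map {A B} h :=
    { idealMap (heytToDL.map h).hom with
      map_himp := fun {I J} hI hJ => by
        obtain ⟨a, rfl⟩ := isCompactElement_ideal_iff.1 hI
        obtain ⟨b, rfl⟩ := isCompactElement_ideal_iff.1 hJ
        change idealMapFun _ (Order.Ideal.principal a ⇨ Order.Ideal.principal b) =
          idealMapFun _ (Order.Ideal.principal a) ⇨ idealMapFun _ (Order.Ideal.principal b)
        rw [principal_himp, idealMapFun_principal, idealMapFun_principal, idealMapFun_principal]
        exact (congrArg _ (map_himp h.hom a b)).trans (principal_himp (h.hom a) (h.hom b)).symm }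
  map_id A := HeytFrmHom.ext fun I =>
    congrArg (fun f : CoherentHom _ _ => f.toFrameHom I) (ideals.map_id (heytToDL.obj A))
  map_comp f g := HeytFrmHom.ext fun I =>
    congrArg (fun f : CoherentHom _ _ => f.toFrameHom I)
      (ideals.map_comp (heytToDL.map f) (heytToDL.map g))

/-! ### Compact elements of a Heyting frame -/

/-- The compact elements of a Heyting frame as a Heyting algebra, with the operations of the
frame. -/
instance (L : Type u) [Order.Frame L] [IsHeytingFrame L] : HeytingAlgebra (CompactElems L) where
  le_top _ := le_top
  bot_le _ := bot_le
  himp a b := ⟨a.1 ⇨ b.1, IsHeytingFrame.isCompact_himp a.2 b.2⟩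
  le_himp_iff a b c := le_himp_iff (a := a.1) (b := b.1) (c := c.1)
  compl a := ⟨a.1 ⇨ ⊥, IsHeytingFrame.isCompact_himp a.2 isCompactElement_bot⟩
  himp_bot _ := rfl

/-- The restriction of the functor of compact elements to Heyting frames. -/
def heytCompactElements : HeytFrm.{u} ⥤ HeytAlg.{u} where
  obj L := HeytAlg.of (CompactElems L.carrier)
  map f := HeytAlg.ofHom
    { toFun := fun a => ⟨f.toFrameHom a.1, f.map_compact a.2⟩
      map_sup' := fun a b => Subtype.ext (map_sup f.toFrameHom a.1 b.1)
      map_inf' := fun a b => Subtype.ext (map_inf f.toFrameHom a.1 b.1)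
      map_bot' := Subtype.ext (map_bot f.toFrameHom)
      map_himp' := fun a b => Subtype.ext (f.map_himp a.2 b.2) }

/-! ### Heyting algebras and Heyting frames -/

/-- A lattice is isomorphic to the lattice of compact elements of its frame of ideals, which are
the principal ideals. -/
noncomputable def principalIso (A : Type u) [DistribLattice A] [BoundedOrder A] :
    A ≃o CompactElems (Order.Ideal A) :=
  RelIso.ofSurjective (OrderEmbedding.ofMapLEIff
    (fun a => (⟨Order.Ideal.principal a, isCompactElement_principal a⟩ :
      CompactElems (Order.Ideal A)))
    fun _ _ => Order.Ideal.principal_le_iff.trans Order.Ideal.mem_principal) fun I => by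
      obtain ⟨a, ha⟩ := isCompactElement_ideal_iff.1 I.2
      exact ⟨a, Subtype.ext ha.symm⟩

section Coherent

variable {L : Type u} [Order.Frame L] [IsCoherentFrame L]

/-- The ideal of the compact elements below `a`. -/
def compactsBelow (a : L) : Order.Ideal (CompactElems L) where
  carrier := {k | k.1 ≤ a}
  lower' _ _ hle hk := le_trans hle hk
  nonempty' := ⟨⊥, bot_le (a := a)⟩
  directed' k hk l hl := ⟨k ⊔ l, sup_le (α := L) hk hl, le_sup_left, le_sup_right⟩

theorem sSup_compactsBelow (a : L) :
    sSup (Subtype.val '' (compactsBelow a : Set (CompactElems L))) = a := by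
  conv_rhs => rw [← sSup_compact_le_eq a]
  congr 1
  ext k
  exact ⟨fun ⟨l, hl, h⟩ => h ▸ ⟨l.2, hl⟩, fun hk => ⟨⟨k, hk.1⟩, hk.2, rfl⟩⟩

/-- An ideal of compact elements consists of the compact elements below its join in the frame:
the ideal is directed, so a compact element below the join is below a member. -/
theorem le_sSup_ideal_iff {k : CompactElems L} {I : Order.Ideal (CompactElems L)} :
    k.1 ≤ sSup (Subtype.val '' (I : Set (CompactElems L))) ↔ k ∈ I := by
  constructor
  · intro h
    obtain ⟨_, ⟨l, hl, rfl⟩, hkl⟩ := k.2 _ _ (I.nonempty.image _)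
      (by
        rintro _ ⟨l, hl, rfl⟩ _ ⟨m, hm, rfl⟩
        exact ⟨_, ⟨l ⊔ m, Order.Ideal.sup_mem hl hm, rfl⟩,
          (le_sup_left : l ≤ l ⊔ m), (le_sup_right : m ≤ l ⊔ m)⟩)
      (isLUB_sSup _) h
    exact I.lower hkl hl
  · exact fun h => le_sSup ⟨k, h, rfl⟩

/-- A coherent frame is isomorphic to the frame of ideals of its compact elements: an ideal
corresponds to its join in the frame. -/
def idealsIso (L : Type u) [Order.Frame L] [IsCoherentFrame L] :
    Order.Ideal (CompactElems L) ≃o L where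
  toFun I := sSup (Subtype.val '' (I : Set (CompactElems L)))
  invFun := compactsBelow
  left_inv I := by
    ext k
    exact le_sSup_ideal_iff
  right_inv := sSup_compactsBelow
  map_rel_iff' {I J} := by
    constructor
    · exact fun h k hk => le_sSup_ideal_iff.1 ((le_sSup_ideal_iff.2 hk).trans h)
    · exact fun h => sSup_le_sSup (Set.image_mono h)

end Coherent

/-- The ideal functor and the functor of compact elements form an equivalence. -/
noncomputable def heytAlgEquivHeytFrm : HeytAlg.{u} ≌ HeytFrm.{u} :=
  CategoryTheory.Equivalence.mk heytIdeals heytCompactElements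
    (NatIso.ofComponents (fun A => HeytAlg.Iso.mk (principalIso A)) fun {A B} f => by
      ext a
      exact Subtype.ext (idealMapFun_principal (heytToDL.map f).hom a).symm)
    (NatIso.ofComponents (fun L => HeytFrm.isoOfOrderIso (idealsIso L.carrier)) fun {L M} f => by
      refine HeytFrmHom.ext fun I => ?_
      change sSup _ = f.toFrameHom (sSup _)
      rw [map_sSup]
      apply le_antisymm
      · refine sSup_le ?_
        rintro _ ⟨k, ⟨l, hl, hkl⟩, rfl⟩
        exact le_trans hkl (le_sSup ⟨_, ⟨l, hl, rfl⟩, rfl⟩)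
      · refine sSup_le ?_
        rintro _ ⟨_, ⟨l, hl, rfl⟩, rfl⟩
        exact le_sSup ⟨⟨f.toFrameHom l.1, f.map_compact l.2⟩, ⟨l, hl, le_rfl⟩, rfl⟩)

/-! ### Separation by points of a coherent frame -/

namespace Pt

section Coherent

variable {L : Type u} [Order.Frame L]

theorem notMem_bot (P : Pt L) : (⊥ : L) ∉ P := fun h => by
  rw [← sSup_empty] at h
  obtain ⟨_, ha, _⟩ := mem_sSup_iff.1 h
  exact ha

theorem mem_sup_iff {P : Pt L} {a b : L} : a ⊔ b ∈ P ↔ a ∈ P ∨ b ∈ P := by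
  rw [← sSup_pair, mem_sSup_iff]
  simp

theorem zeta_inf (a b : L) : zeta (a ⊓ b) = zeta a ∩ zeta b := Set.ext fun _ => mem_inf_iff

theorem zeta_sup (a b : L) : zeta (a ⊔ b) = zeta a ∪ zeta b := Set.ext fun _ => mem_sup_iff

variable [IsCoherentFrame L]

theorem le_of_forall_compact {P Q : Pt L} (h : ∀ k, IsCompactElement k → k ∈ P → k ∈ Q) :
    P ≤ Q := fun a ha => by
  obtain ⟨k, hk, hka, hkP⟩ := exists_compact_of_mem ha
  exact mem_of_le hka (h k hk hkP)

/-- The point of a coherent frame given by a prime ideal `J` of its compact elements: it consists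
of the elements above some compact element outside `J`. -/
def ofPrime (J : Order.Ideal (CompactElems L)) (hJ : J.IsPrime) : Pt L where
  toPFilter := Order.IsPFilter.toPFilter (F := {a | ∃ k, k ∉ J ∧ k.1 ≤ a}) <| by
    refine Order.IsPFilter.of_def ?_ ?_ ?_
    · obtain ⟨k, hk⟩ := Set.ne_univ_iff_exists_notMem _ |>.1 hJ.ne_univ
      exact ⟨k.1, k, hk, le_rfl⟩
    · rintro a ⟨k, hk, hka⟩ b ⟨l, hl, hlb⟩
      refine ⟨a ⊓ b, ⟨k ⊓ l, fun h => ?_, inf_le_inf hka hlb⟩, inf_le_left, inf_le_right⟩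
      exact (hJ.mem_or_mem h).elim hk hl
    · rintro a b hab ⟨k, hk, hka⟩
      exact ⟨k, hk, hka.trans hab⟩
  completelyPrime := by
    rintro S ⟨k, hk, hkS⟩
    -- Otherwise every compact element below a member of `S`, and hence every compact element
    -- below `sSup S`, belongs to `J`.
    by_contra! h
    refine hk (le_sSup_ideal_iff.1 (hkS.trans (sSup_le fun a ha => ?_)))
    rw [← sSup_compact_le_eq a]
    refine sSup_le_sSup fun l hl => ⟨⟨l, hl.1⟩, ?_, rfl⟩
    by_contra hlJ
    exact h a ha ⟨⟨l, hl.1⟩, hlJ, hl.2⟩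

theorem mem_ofPrime {J : Order.Ideal (CompactElems L)} {hJ : J.IsPrime} {k : CompactElems L} :
    k.1 ∈ ofPrime J hJ ↔ k ∉ J :=
  ⟨fun ⟨_, hl, hlk⟩ hk => hl (J.lower hlk hk), fun hk => ⟨k, hk, le_rfl⟩⟩

/-- The prime ideal theorem for points: a filter and an ideal of compact elements that do not meet
are separated by a point. -/
theorem exists_separating {F : Order.PFilter (CompactElems L)}
    {I : Order.Ideal (CompactElems L)} (h : Disjoint (F : Set (CompactElems L)) I) :
    ∃ P : Pt L, (∀ k ∈ F, k.1 ∈ P) ∧ ∀ k ∈ I, k.1 ∉ P := by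
  obtain ⟨J, hJ, hIJ, hFJ⟩ := DistribLattice.prime_ideal_of_disjoint_filter_ideal h
  exact ⟨ofPrime J hJ, fun k hk => mem_ofPrime.2 (Set.disjoint_left.1 hFJ hk),
    fun k hk hkP => mem_ofPrime.1 hkP (hIJ hk)⟩

/-- The filter of the compact elements that belong to a point. -/
def compacts (P : Pt L) : Order.PFilter (CompactElems L) :=
  Order.IsPFilter.toPFilter (F := {k : CompactElems L | k.1 ∈ P}) <|
    Order.IsPFilter.of_def ⟨⊤, mem_top P⟩
      (fun k hk l hl => ⟨k ⊓ l, mem_inf_iff.2 ⟨hk, hl⟩, inf_le_left, inf_le_right⟩)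
      fun hkl hk => mem_of_le hkl hk

/-- The ideal of the compact elements outside a point. -/
def compactsCompl (P : Pt L) : Order.Ideal (CompactElems L) where
  carrier := {k | k.1 ∉ P}
  lower' _ _ hle hk h := hk (mem_of_le hle h)
  nonempty' := ⟨⊥, notMem_bot P⟩
  directed' k hk l hl := ⟨k ⊔ l, fun h => (mem_sup_iff.1 h).elim hk hl, le_sup_left, le_sup_right⟩

/-- The filter generated by the filters `F` and `G`. -/
def supFilter {A : Type u} [Lattice A] (F G : Order.PFilter A) : Order.PFilter A :=
  Order.IsPFilter.toPFilter (F := {c | ∃ a ∈ F, ∃ b ∈ G, a ⊓ b ≤ c}) <| by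
    refine Order.IsPFilter.of_def ?_ ?_ ?_
    · obtain ⟨a, ha⟩ := F.nonempty
      obtain ⟨b, hb⟩ := G.nonempty
      exact ⟨_, a, ha, b, hb, le_rfl⟩
    · rintro c ⟨a, ha, b, hb, hc⟩ d ⟨a', ha', b', hb', hd⟩
      refine ⟨c ⊓ d, ⟨a ⊓ a', Order.PFilter.inf_mem ha ha', b ⊓ b', Order.PFilter.inf_mem hb hb',
        ?_⟩, inf_le_left, inf_le_right⟩
      rw [inf_inf_inf_comm]
      exact inf_le_inf hc hd
    · rintro c d hcd ⟨a, ha, b, hb, hc⟩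
      exact ⟨a, ha, b, hb, hc.trans hcd⟩

theorem mem_supFilter {A : Type u} [Lattice A] {F G : Order.PFilter A} {c : A} :
    c ∈ supFilter F G ↔ ∃ a ∈ F, ∃ b ∈ G, a ⊓ b ≤ c := Iff.rfl

/-- A coherent frame is spatial. -/
theorem zeta_subset_iff {a b : L} : zeta a ⊆ zeta b ↔ a ≤ b := by
  refine ⟨fun h => ?_, zeta_mono⟩
  rw [← sSup_compact_le_eq a]
  refine sSup_le fun k hk => ?_
  by_contra hkb
  obtain ⟨P, hPk, hPb⟩ := exists_separating (L := L) (F := Order.PFilter.principal ⟨k, hk.1⟩)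
    (I := compactsBelow b)
    (Set.disjoint_left.2 fun l hl hlb => hkb (le_trans (Order.PFilter.mem_principal.1 hl) hlb))
  obtain ⟨l, hl, hlb, hlP⟩ := exists_compact_of_mem
    (h (mem_of_le hk.2 (hPk _ (Order.PFilter.mem_principal.2 le_rfl))))
  exact hPb ⟨l, hl⟩ hlb hlP

/-! ### The patch topology -/

/-- The sets `ζ(a) \ ζ(b)` with `a` and `b` compact form a basis of the patch topology. -/
theorem exists_basic_of_isOpen {U : Set (Pt L)} (hU : IsOpen U) {P : Pt L} (hP : P ∈ U) :
    ∃ a b : L, IsCompactElement a ∧ IsCompactElement b ∧ P ∈ zeta a \ zeta b ∧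
      zeta a \ zeta b ⊆ U := by
  induction hU with
  | basic s hs =>
    obtain ⟨k, hk, rfl | rfl⟩ := subbasis_cases hs
    · exact ⟨k, ⊥, hk, isCompactElement_bot, ⟨hP, notMem_bot P⟩, Set.sdiff_subset⟩
    · exact ⟨⊤, k, IsCoherentFrame.isCompact_top, hk, ⟨mem_top P, hP⟩, fun _ h => h.2⟩
  | univ =>
    exact ⟨⊤, ⊥, IsCoherentFrame.isCompact_top, isCompactElement_bot,
      ⟨mem_top P, notMem_bot P⟩, Set.subset_univ _⟩
  | inter s t _ _ ihs iht =>
    obtain ⟨a, b, ha, hb, hP₁, hs⟩ := ihs hP.1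
    obtain ⟨c, d, hc, hd, hP₂, ht⟩ := iht hP.2
    refine ⟨a ⊓ c, b ⊔ d, IsCoherentFrame.isCompact_inf ha hc, isCompactElement_sup hb hd, ?_, ?_⟩
    · rw [zeta_inf, zeta_sup]
      exact ⟨⟨hP₁.1, hP₂.1⟩, fun h => h.elim hP₁.2 hP₂.2⟩
    · rw [zeta_inf, zeta_sup]
      exact fun Q hQ => ⟨hs ⟨hQ.1.1, fun h => hQ.2 (Or.inl h)⟩,
        ht ⟨hQ.1.2, fun h => hQ.2 (Or.inr h)⟩⟩
  | sUnion S _ ih =>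
    obtain ⟨s, hs, hPs⟩ := hP
    obtain ⟨a, b, ha, hb, hPab, hab⟩ := ih s hs hPs
    exact ⟨a, b, ha, hb, hPab, hab.trans (Set.subset_sUnion_of_mem hs)⟩

theorem isOpen_zeta (a : L) : IsOpen (zeta a) := by
  rw [← sSup_compact_le_eq a, zeta_sSup]
  exact isOpen_biUnion fun k hk => (isClopen_zeta hk.1).isOpen

/-- The open upsets of the space of points are exactly the sets `ζ(a)`. -/
theorem exists_zeta_eq {U : Set (Pt L)} (hU : IsOpen U) (hup : IsUpperSet U) :
    ∃ a : L, zeta a = U := by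
  refine ⟨sSup {k | IsCompactElement k ∧ zeta k ⊆ U}, ?_⟩
  rw [zeta_sSup]
  apply Set.Subset.antisymm
  · exact Set.iUnion₂_subset fun k hk => hk.2
  · intro P hP
    -- The sets `(ζ(k))ᶜ` with `k ∈ P` cover the complement of `U`, because a point that contains
    -- all compact elements of `P` lies above `P`.
    have : Nonempty {k : CompactElems L // k.1 ∈ P} := ⟨⟨⊤, mem_top P⟩⟩
    obtain ⟨k, hk⟩ := hU.isClosed_compl.isCompact.elim_directed_cover
      (fun k : {k : CompactElems L // k.1 ∈ P} => (zeta k.1.1)ᶜ)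
      (fun k => (isClopen_zeta k.1.2).compl.isOpen)
      (fun Q hQ => by
        have hPQ : ¬P ≤ Q := fun h => hQ (hup h hP)
        by_contra hQ'
        refine hPQ (le_of_forall_compact fun k hk hkP => ?_)
        by_contra hkQ
        exact hQ' (Set.mem_iUnion.2 ⟨⟨⟨k, hk⟩, hkP⟩, hkQ⟩))
      (fun k l => ⟨⟨k.1 ⊓ l.1, mem_inf_iff.2 ⟨k.2, l.2⟩⟩,
        Set.compl_subset_compl.2 (zeta_mono inf_le_left),
        Set.compl_subset_compl.2 (zeta_mono inf_le_right)⟩)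
    exact Set.mem_iUnion₂.2 ⟨k.1.1, ⟨k.1.2, Set.compl_subset_compl.1 hk⟩, k.2⟩

/-- A coherent frame is isomorphic to the frame of open upsets of its space of points. -/
noncomputable def zetaIso (L : Type u) [Order.Frame L] [IsCoherentFrame L] : L ≃o OpUp (Pt L) :=
  RelIso.ofSurjective (OrderEmbedding.ofMapLEIff
    (fun a => (⟨zeta a, isOpen_zeta a, fun _ _ hle ha => hle ha⟩ : OpUp (Pt L)))
    fun _ _ => zeta_subset_iff) fun U => by
      obtain ⟨a, ha⟩ := exists_zeta_eq U.isOpen U.isUpper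
      exact ⟨a, OpUp.ext ha⟩

end Coherent

/-! ### The Esakia space of points of a Heyting frame -/

section Heyting

variable {L M : Type u} [Order.Frame L] [IsHeytingFrame L] [Order.Frame M] [IsHeytingFrame M]

/-- Suppose `a ⇨ b ∉ P`. The filter generated by `P` and `a` does not contain `b`, so some point
above `P` contains `a` but not `b`. -/
theorem lowerClosure_zeta_diff {a b : L} (ha : IsCompactElement a) (hb : IsCompactElement b) :
    (lowerClosure (zeta a \ zeta b) : Set (Pt L)) = (zeta (a ⇨ b))ᶜ := by
  ext P
  constructor
  · rintro ⟨Q, ⟨haQ, hbQ⟩, hle⟩ hP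
    exact hbQ (mem_of_le himp_inf_le (mem_inf_iff.2 ⟨hle hP, haQ⟩))
  · intro hP
    obtain ⟨Q, hQF, hQI⟩ := exists_separating (L := L)
      (F := supFilter (compacts P) (Order.PFilter.principal ⟨a, ha⟩))
      (I := Order.Ideal.principal ⟨b, hb⟩) (Set.disjoint_left.2 fun k hk hkb => by
        obtain ⟨p, hp, q, hq, hpq⟩ := mem_supFilter.1 hk
        refine hP (mem_of_le (le_himp_iff.2 ?_) hp)
        exact (inf_le_inf_left p.1 (Order.PFilter.mem_principal.1 hq)).trans
          (le_trans hpq (Order.Ideal.mem_principal.1 hkb)))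
    refine ⟨Q, ⟨?_, hQI ⟨b, hb⟩ le_rfl⟩, le_of_forall_compact fun k hk hkP => ?_⟩
    · exact hQF ⟨a, ha⟩
        ⟨⊤, mem_top P, ⟨a, ha⟩, Order.PFilter.mem_principal.2 le_rfl, inf_le_right⟩
    · exact hQF ⟨k, hk⟩
        ⟨⟨k, hk⟩, hkP, ⟨a, ha⟩, Order.PFilter.mem_principal.2 le_rfl, inf_le_left⟩

/-- A clopen set is compact, hence a finite union of basic sets `ζ(a) \ ζ(b)`, and downsets
commute with unions. -/
theorem isClopen_lowerClosure {U : Set (Pt L)} (hU : IsClopen U) :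
    IsClopen (lowerClosure U : Set (Pt L)) := by
  have h : ∀ P ∈ U, ∃ V : Set (Pt L), IsOpen V ∧ P ∈ V ∧ V ⊆ U ∧
      IsClopen (lowerClosure V : Set (Pt L)) := fun P hP => by
    obtain ⟨a, b, ha, hb, hPab, hab⟩ := exists_basic_of_isOpen hU.isOpen hP
    refine ⟨_, ((isClopen_zeta ha).diff (isClopen_zeta hb)).isOpen, hPab, hab, ?_⟩
    rw [lowerClosure_zeta_diff ha hb]
    exact (isClopen_zeta (IsHeytingFrame.isCompact_himp ha hb)).compl
  choose! V hV using h
  obtain ⟨t, ht, hcov⟩ := hU.isClosed.isCompact.elim_nhds_subcover V fun P hP =>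
    (hV P hP).1.mem_nhds (hV P hP).2.1
  have hUt : U = ⋃ P ∈ t, V P :=
    hcov.antisymm (Set.iUnion₂_subset fun P hP => (hV P (ht P hP)).2.2.1)
  have hdown : (lowerClosure U : Set (Pt L)) = ⋃ P ∈ t, (lowerClosure (V P) : Set (Pt L)) := by
    rw [hUt]
    simp [lowerClosure_iUnion]
  rw [hdown]
  exact t.finite_toSet.isClopen_biUnion fun P hP => (hV P (ht P hP)).2.2.2

/-- The filter `↑h[F]` generated by the image of a filter under a bounded lattice homomorphism. -/
def mapFilter {A B : Type u} [Lattice A] [BoundedOrder A] [Lattice B] [BoundedOrder B]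
    (h : BoundedLatticeHom A B) (F : Order.PFilter A) : Order.PFilter B :=
  Order.IsPFilter.toPFilter (F := {b | ∃ a ∈ F, h a ≤ b}) <| by
    refine Order.IsPFilter.of_def ?_ ?_ ?_
    · obtain ⟨a, ha⟩ := F.nonempty
      exact ⟨_, a, ha, le_rfl⟩
    · rintro b ⟨a, ha, hb⟩ b' ⟨a', ha', hb'⟩
      refine ⟨b ⊓ b', ⟨a ⊓ a', Order.PFilter.inf_mem ha ha', ?_⟩, inf_le_left, inf_le_right⟩
      rw [map_inf]
      exact inf_le_inf hb hb'
    · rintro b b' hbb' ⟨a, ha, hb⟩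
      exact ⟨a, ha, hb.trans hbb'⟩

/-- The map `α⁻¹` on points is a p-morphism: if `α⁻¹(P) ⊆ Q`, then the filter generated by `P`
and `α[Q]` avoids the ideal generated by `α` of the complement of `Q`, and a point separating the
two is the required preimage of `Q`. -/
theorem exists_le_comapFun_eq (f : HeytFrmHom L M) {P : Pt M} {Q : Pt L}
    (hle : comapFun f.toFrameHom P ≤ Q) : ∃ R : Pt M, P ≤ R ∧ comapFun f.toFrameHom R = Q := by
  let h : BoundedLatticeHom (CompactElems L) (CompactElems M) :=
    (compactElements.map (X := ⟨L⟩) (Y := ⟨M⟩) f.toCoherentHom).hom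
  obtain ⟨R, hRF, hRI⟩ := exists_separating (L := M)
    (F := supFilter (compacts P) (mapFilter h (compacts Q)))
    (I := idealMapFun h (compactsCompl Q)) (Set.disjoint_left.2 fun k hk hkI => by
      obtain ⟨p, hp, l, ⟨q, hq, hql⟩, hpl⟩ := mem_supFilter.1 hk
      obtain ⟨b, hb, hkb⟩ := hkI
      have hp' : p.1 ≤ f.toFrameHom (q.1 ⇨ b.1) := by
        rw [f.map_himp q.2 b.2, le_himp_iff]
        exact (inf_le_inf_left p.1 hql).trans (le_trans hpl hkb)
      have hqb : q.1 ⇨ b.1 ∈ Q := hle (mem_of_le (P := P) hp' hp)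
      exact hb (mem_of_le himp_inf_le (mem_inf_iff.2 ⟨hqb, hq⟩)))
  have key : ∀ k (hk : IsCompactElement k), f.toFrameHom k ∈ R ↔ k ∈ Q := fun k hk => by
    constructor
    · intro hkR
      by_contra hkQ
      exact hRI (h ⟨k, hk⟩) ⟨⟨k, hk⟩, hkQ, le_rfl⟩ hkR
    · intro hkQ
      exact hRF (h ⟨k, hk⟩) ⟨⊤, mem_top P, h ⟨k, hk⟩, ⟨⟨k, hk⟩, hkQ, le_rfl⟩, inf_le_right⟩
  refine ⟨R, le_of_forall_compact fun k hk hkP => ?_, le_antisymm ?_ ?_⟩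
  · exact hRF ⟨k, hk⟩ ⟨⟨k, hk⟩, hkP, ⊤, ⟨⊤, mem_top Q, le_top⟩, inf_le_left⟩
  · exact le_of_forall_compact fun k hk => (key k hk).1
  · exact le_of_forall_compact fun k hk => (key k hk).2

end Heyting

end Pt

/-- The restriction of the functor of points to Heyting frames. -/
def heytPoints : HeytFrm.{u}ᵒᵖ ⥤ ES.{u} where
  obj L := { carrier := Pt L.unop.carrier, isClopen_down := fun _ => Pt.isClopen_lowerClosure }
  map f :=
    { Pt.comap f.unop.toCoherentHom with
      exists_map_eq_of_map_le' := fun _ _ hle => Pt.exists_le_comapFun_eq f.unop hle }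

/-! ### The Heyting frame of open upsets of an Esakia space -/

namespace OpUp

section Frame

variable {X Y : Type u} [PartialOrder X] [TopologicalSpace X] [PartialOrder Y] [TopologicalSpace Y]

/-- The implication `U ⇨ V` is the complement of the downset of `U \ V`, which is the largest upset
whose intersection with `U` lies in `V`; the complement has to be open to be an element of the
frame. -/
theorem mem_himp {U V : OpUp X} (h : IsClosed (lowerClosure ((U : Set X) \ V) : Set X)) {x : X} :
    x ∈ U ⇨ V ↔ x ∉ lowerClosure ((U : Set X) \ V) := by
  constructor
  · rintro hx ⟨y, ⟨hyU, hyV⟩, hxy⟩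
    exact hyV ((himp_inf_le : (U ⇨ V) ⊓ U ≤ V) ⟨(U ⇨ V).isUpper hxy hx, hyU⟩)
  · intro hx
    let W : OpUp X := ⟨_, h.isOpen_compl, (lowerClosure ((U : Set X) \ V)).lower.compl⟩
    have hW : W ≤ U ⇨ V := le_himp_iff.2 fun y hy => by
      by_contra hyV
      exact hy.1 (subset_lowerClosure ⟨hy.2, hyV⟩)
    exact hW hx

theorem himp_carrier {U V : OpUp X} (h : IsClosed (lowerClosure ((U : Set X) \ V) : Set X)) :
    (U ⇨ V : OpUp X) = (lowerClosure ((U : Set X) \ V) : Set X)ᶜ := Set.ext fun _ => mem_himp h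

end Frame

end OpUp

theorem isHeytingFrame_opUp (X : ES.{u}) : IsHeytingFrame (OpUp X.carrier) where
  isCompact_himp {U V} hU hV := by
    rw [OpUp.isCompactElement_iff] at *
    have h := X.isClopen_down _ (hU.diff hV)
    rw [OpUp.himp_carrier h.isClosed]
    exact h.compl

/-- Preimages under Esakia morphisms preserve the implication of clopen upsets, because they commute
with downsets. -/
theorem preimage_himp {X Y : ES.{u}} (f : X ⟶ Y) {U V : OpUp Y.carrier}
    (hU : IsClopen (U : Set Y.carrier)) (hV : IsClopen (V : Set Y.carrier)) :
    (OpUp.preimage (ES.toPS.map f)).toFrameHom (U ⇨ V) =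
      (OpUp.preimage (ES.toPS.map f)).toFrameHom U ⇨
        (OpUp.preimage (ES.toPS.map f)).toFrameHom V := by
  have hf : Continuous f.toFun := f.continuous_toFun
  have h := X.isClopen_down _ ((hU.preimage hf).diff (hV.preimage hf))
  refine SetLike.ext fun x => ?_
  change f.toFun x ∈ U ⇨ V ↔ _
  rw [OpUp.mem_himp (Y.isClopen_down _ (hU.diff hV)).isClosed, OpUp.mem_himp h.isClosed,
    not_iff_not]
  constructor
  · rintro ⟨y, hy, hle⟩
    obtain ⟨z, hxz, rfl⟩ := f.exists_map_eq_of_map_le' hle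
    exact ⟨z, hy, hxz⟩
  · rintro ⟨z, hz, hle⟩
    exact ⟨f.toFun z, hz, f.monotone' hle⟩

/-- The restriction of the functor of open upsets to Esakia spaces. -/
def esakiaOpenUpsets : ES.{u} ⥤ HeytFrm.{u}ᵒᵖ where
  obj X := Opposite.op { carrier := OpUp X.carrier, heyting := isHeytingFrame_opUp X }
  map {X Y} f := Quiver.Hom.op (V := HeytFrm.{u})
    (X := { carrier := OpUp Y.carrier, heyting := isHeytingFrame_opUp Y })
    (Y := { carrier := OpUp X.carrier, heyting := isHeytingFrame_opUp X })
    { OpUp.preimage (ES.toPS.map f) with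
      map_himp := fun hU hV => preimage_himp f (OpUp.isCompactElement_iff.1 hU)
        (OpUp.isCompactElement_iff.1 hV) }

/-! ### Points of the frame of open upsets -/

section Priestley

variable {X : Type u} [PartialOrder X] [TopologicalSpace X]

/-- The point of the frame of open upsets that consists of the neighbourhoods of `x`. -/
def pointOf (x : X) : Pt (OpUp X) where
  toPFilter := Order.IsPFilter.toPFilter (F := {U : OpUp X | x ∈ U}) <|
    Order.IsPFilter.of_def ⟨⊤, trivial⟩
      (fun U hU V hV => ⟨U ⊓ V, ⟨hU, hV⟩, inf_le_left, inf_le_right⟩) fun hUV hU => hUV hU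
  completelyPrime _ h := OpUp.mem_sSup.1 h

variable [PriestleySpace X]

theorem pointOf_le_iff {x y : X} : pointOf x ≤ pointOf y ↔ x ≤ y := by
  refine ⟨fun h => ?_, fun h U hU => U.isUpper h hU⟩
  by_contra hxy
  obtain ⟨U, hU, hup, hx, hy⟩ := exists_isClopen_upper_of_not_le hxy
  exact hy (h (show (⟨U, hU.isOpen, hup⟩ : OpUp X) ∈ pointOf x from hx))

variable [CompactSpace X]

theorem continuous_pointOf : Continuous (pointOf : X → Pt (OpUp X)) := by
  refine continuous_generateFrom_iff.2 fun s hs => ?_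
  obtain ⟨U, hU, rfl | rfl⟩ := Pt.subbasis_cases hs
  · exact U.isOpen
  · exact (OpUp.isCompactElement_iff.1 hU).compl.isOpen

/-- Every point of the frame of open upsets of a Priestley space is given by an element: the
elements form a closed set of points, as a continuous image of a compact space, and they are dense,
because `ζ(U) \ ζ(V)` contains the point given by any element of `U \ V`. -/
theorem pointOf_surjective : Function.Surjective (pointOf : X → Pt (OpUp X)) := by
  refine Set.range_eq_univ.1 ((isCompact_range continuous_pointOf).isClosed.closure_eq.symm.trans
    (Dense.closure_eq ?_))
  intro P
  refine mem_closure_iff.2 fun W hW hP => ?_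
  obtain ⟨U, V, _, _, hPUV, hUV⟩ := Pt.exists_basic_of_isOpen hW hP
  have hle : ¬U ≤ V := fun h => hPUV.2 (Pt.mem_of_le h hPUV.1)
  obtain ⟨x, hxU, hxV⟩ := SetLike.not_le_iff_exists.1 hle
  exact ⟨pointOf x, hUV ⟨hxU, hxV⟩, x, rfl⟩

/-- A Priestley space is order isomorphic to the space of points of its frame of open upsets. -/
noncomputable def pointIso (X : Type u) [PartialOrder X] [TopologicalSpace X] [CompactSpace X]
    [PriestleySpace X] : X ≃o Pt (OpUp X) :=
  RelIso.ofSurjective (OrderEmbedding.ofMapLEIff pointOf fun _ _ => pointOf_le_iff)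
    pointOf_surjective

end Priestley

/-- A continuous order isomorphism as an Esakia morphism. -/
def esakiaHomOfOrderIso {X Y : Type u} [PartialOrder X] [TopologicalSpace X] [PartialOrder Y]
    [TopologicalSpace Y] (e : X ≃o Y) (he : Continuous e) : EsakiaHom X Y where
  toFun := e
  monotone' := e.monotone
  continuous_toFun := he
  exists_map_eq_of_map_le' _ b hle := ⟨e.symm b, e.le_symm_apply.2 hle, e.apply_symm_apply b⟩

/-- A continuous order isomorphism of Esakia spaces as an isomorphism in the category of Esakia
spaces; its inverse is continuous because the spaces are compact and Hausdorff. -/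
def ES.isoOfOrderIso {X Y : ES.{u}} (e : X.carrier ≃o Y.carrier) (he : Continuous e) : X ≅ Y where
  hom := esakiaHomOfOrderIso e he
  inv := esakiaHomOfOrderIso e.symm (he.continuous_symm_of_equiv_compact_to_t2 (f := e.toEquiv))
  hom_inv_id := EsakiaHom.ext e.symm_apply_apply
  inv_hom_id := EsakiaHom.ext e.apply_symm_apply

/-- Esakia duality for Heyting frames: the functors of points and of open upsets form a dual
equivalence. -/
noncomputable def heytFrmOpEquivES : HeytFrm.{u}ᵒᵖ ≌ ES.{u} :=
  CategoryTheory.Equivalence.mk heytPoints esakiaOpenUpsets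
    (NatIso.ofComponents (fun L => (HeytFrm.isoOfOrderIso (L := L.unop)
        (M := (esakiaOpenUpsets.obj (heytPoints.obj L)).unop) (Pt.zetaIso L.unop.carrier)).op)
      fun _ => Quiver.Hom.unop_inj (HeytFrmHom.ext fun _ => rfl)).symm
    (NatIso.ofComponents (fun X => ES.isoOfOrderIso (X := X)
        (Y := heytPoints.obj (esakiaOpenUpsets.obj X)) (pointIso X.carrier) continuous_pointOf)
      fun _ => rfl).symm

end HeytingFrames

theorem theorem3p9 :
    (∃ e : HeytAlg.{u} ≌ HeytingFrames.HeytFrm.{u},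
      e.functor ⋙ HeytingFrames.HeytFrm.toCohFrm =
        HeytingFrames.heytToDL ⋙ HeytingFrames.ideals ∧
      e.inverse ⋙ HeytingFrames.heytToDL =
        HeytingFrames.HeytFrm.toCohFrm ⋙ HeytingFrames.compactElements) ∧
    (∃ d : HeytingFrames.HeytFrm.{u}ᵒᵖ ≌ HeytingFrames.ES.{u},
      d.functor ⋙ HeytingFrames.ES.toPS =
        HeytingFrames.HeytFrm.toCohFrm.op ⋙ HeytingFrames.points ∧
      d.inverse ⋙ HeytingFrames.HeytFrm.toCohFrm.op =
        HeytingFrames.ES.toPS ⋙ HeytingFrames.openUpsets) :=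
  ⟨⟨HeytingFrames.heytAlgEquivHeytFrm, rfl, rfl⟩, ⟨HeytingFrames.heytFrmOpEquivES, rfl, rfl⟩⟩
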